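/- Modal formulas over a set of atomic propositions are built from atoms by $\neg$, $\to$ and $\Box$, with $\lozenge A := \neg\Box\neg A$ and $A \lor B := \neg A \to B$. A normal modal logic is the least set of formulas that contains classical propositional logic, the axioms $\Box(A\to B)\to(\Box A\to\Box B)$ and its additional axioms, and that is closed under modus ponens and necessitation ($A \vdash \Box A$). The additional axiom schemata are: for $S4$, $\Box A\to A$ and $\Box A\to\Box\Box A$; for $S4.3$, those of $S4$ and $\Box(\Box A\to B)\lor\Box(\Box B\to A)$; for $S5$, those of $S4$ and $\lozenge A\to\Box\lozenge A$. A Kripke frame is a set $W$ with a binary relation $R$ on $W$. A formula is valid in $(W,R)$ if it holds at every world of every Kripke model on $(W,R)$, and valid in a class of frames if it is valid in each of its members. A logic $L$ is sound for a class $C$ if each formula in $L$ is valid in $C$, and complete for $C$ if each formula valid in $C$ is in $L$. A dynamical system consists of a (not necessarily commutative) monoid $\mathbb T=(T,0,+)$, a set $S$ and a map $\Phi:S\times T\to S$ with $\Phi(s,0)=s$ and $\Phi(\Phi(s,t),u)=\Phi(s,t+u)$. Write $a\le_{\mathbb T}b$ if $a+c=b$ for some $c\in T$. The system is linear-time if $a\le_{\mathbb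 T}b$ or $b\le_{\mathbb T}a$ for all $a,b\in T$, and invertible if $a\le_{\mathbb T}b$ implies $b\le_{\mathbb T}a$ for all $a,b\in T$. A Kripke frame $(W,R)$ is orbital if there is a dynamical system with state space $W$ such that, for all $x,y\in W$, $x\mathrel R y$ holds if and only if $y=\Phi(x,t)$ for some $t\in T$; it is linear-time orbital, respectively invertible orbital, if such a system can be chosen linear-time, respectively invertible. **Theorem.** The logic $S4$ is sound and complete for the class of orbital frames, $S4.3$ is sound and complete for the class of linear-time orbital frames, and $S5$ is sound and complete for the class of invertible orbital frames. -/

import Mathlib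

universe u v w

/-! Syntax of propositional modal logic -/

/-- Formulas over a type `α` of atomic propositions, with primitive connectives
`¬`, `→` and `□`. -/
inductive ModalFormula (α : Type u) : Type u
  | atom : α → ModalFormula α
  | neg : ModalFormula α → ModalFormula α
  | imp : ModalFormula α → ModalFormula α → ModalFormula α
  | box : ModalFormula α → ModalFormula α

namespace ModalFormula

/-- `◇A` is `¬□¬A`. -/
def dia {α : Type u} (A : ModalFormula α) : ModalFormula α := neg (box (neg A))

/-- Classical disjunction: `A ∨ B` is `¬A → B`. -/
def disj {α : Type u} (A B : ModalFormula α) : ModalFormula α := imp (neg A) B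

end ModalFormula

open ModalFormula in
/-- Theorems of the normal modal logic axiomatized by `Ax`: the least set of formulas that
contains the axioms of classical propositional logic in `¬, →` (Łukasiewicz's three schemata),
the distribution axiom and all members of `Ax`, and that is closed under modus ponens and
necessitation. -/
inductive NormalTheorem {α : Type u} (Ax : Set (ModalFormula α)) : ModalFormula α → Prop
  | ax {A : ModalFormula α} : A ∈ Ax → NormalTheorem Ax A
  | weaken (A B : ModalFormula α) : NormalTheorem Ax (imp A (imp B A))
  | frege (A B C : ModalFormula α) :
      NormalTheorem Ax (imp (imp A (imp B C)) (imp (imp A B) (imp A C)))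
  | contrapose (A B : ModalFormula α) :
      NormalTheorem Ax (imp (imp (neg A) (neg B)) (imp B A))
  | distribution (A B : ModalFormula α) :
      NormalTheorem Ax (imp (box (imp A B)) (imp (box A) (box B)))
  | modusPonens {A B : ModalFormula α} :
      NormalTheorem Ax (imp A B) → NormalTheorem Ax A → NormalTheorem Ax B
  | necessitation {A : ModalFormula α} : NormalTheorem Ax A → NormalTheorem Ax (box A)

namespace ModalFormula

/-- All instances of `□A → A`. -/
def axiomsT (α : Type u) : Set (ModalFormula α) :=
  {F | ∃ A : ModalFormula α, F = imp (box A) A}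

/-- All instances of `□A → □□A`. -/
def axioms4 (α : Type u) : Set (ModalFormula α) :=
  {F | ∃ A : ModalFormula α, F = imp (box A) (box (box A))}

/-- All instances of `□(□A → B) ∨ □(□B → A)`. -/
def axioms3 (α : Type u) : Set (ModalFormula α) :=
  {F | ∃ A B : ModalFormula α, F = disj (box (imp (box A) B)) (box (imp (box B) A))}

/-- All instances of `◇A → □◇A`. -/
def axioms5 (α : Type u) : Set (ModalFormula α) :=
  {F | ∃ A : ModalFormula α, F = imp (dia A) (box (dia A))}

end ModalFormula

/-- A modal logic is identified with its set of theorems. -/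
def logicS4 (α : Type u) : Set (ModalFormula α) :=
  {A | NormalTheorem (ModalFormula.axiomsT α ∪ ModalFormula.axioms4 α) A}

def logicS43 (α : Type u) : Set (ModalFormula α) :=
  {A | NormalTheorem
    (ModalFormula.axiomsT α ∪ ModalFormula.axioms4 α ∪ ModalFormula.axioms3 α) A}

def logicS5 (α : Type u) : Set (ModalFormula α) :=
  {A | NormalTheorem
    (ModalFormula.axiomsT α ∪ ModalFormula.axioms4 α ∪ ModalFormula.axioms5 α) A}

/-! Kripke semantics -/

structure KripkeFrame where
  World : Type v
  Rel : World → World → Prop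

/-- A Kripke model on the frame `F`, given by the satisfaction of atomic propositions. -/
structure KripkeModel (α : Type u) (F : KripkeFrame.{v}) where
  val : F.World → α → Prop

/-- The satisfaction relation of a model: the unique relation between worlds and formulas that
extends the satisfaction of atoms and obeys the clauses for `¬`, `→` and `□`. -/
def KripkeModel.Sat {α : Type u} {F : KripkeFrame.{v}} (M : KripkeModel α F) :
    F.World → ModalFormula α → Prop
  | x, .atom p => M.val x p
  | x, .neg A => ¬ M.Sat x A
  | x, .imp A B => ¬ M.Sat x A ∨ M.Sat x B
  | x, .box A => ∀ y, F.Rel x y → M.Sat y A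

def KripkeModel.Valid {α : Type u} {F : KripkeFrame.{v}} (M : KripkeModel α F)
    (A : ModalFormula α) : Prop :=
  ∀ x : F.World, M.Sat x A

def KripkeFrame.Valid {α : Type u} (F : KripkeFrame.{v}) (A : ModalFormula α) : Prop :=
  ∀ M : KripkeModel α F, M.Valid A

/-- Validity in a class of frames. -/
def ValidInClass {α : Type u} (C : Set KripkeFrame.{v}) (A : ModalFormula α) : Prop :=
  ∀ F ∈ C, F.Valid A

def SoundFor {α : Type u} (L : Set (ModalFormula α)) (C : Set KripkeFrame.{v}) : Prop :=
  ∀ A : ModalFormula α, A ∈ L → ValidInClass C A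

def CompleteFor {α : Type u} (L : Set (ModalFormula α)) (C : Set KripkeFrame.{v}) : Prop :=
  ∀ A : ModalFormula α, ValidInClass C A → A ∈ L

/-! Monoids as time; dynamical systems -/

/-- The order induced by a (not necessarily commutative) monoid. -/
def MonoidLE (T : Type w) [AddMonoid T] (a b : T) : Prop := ∃ c : T, a + c = b

def LinearTime (T : Type w) [AddMonoid T] : Prop :=
  ∀ a b : T, MonoidLE T a b ∨ MonoidLE T b a

def SymmetricTime (T : Type w) [AddMonoid T] : Prop :=
  ∀ a b : T, MonoidLE T a b → MonoidLE T b a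

/-- A dynamical system with time monoid `T` and state space `S`: a right action of `T` on `S`. -/
structure DynSystem (T : Type w) [AddMonoid T] (S : Type v) where
  flow : S → T → S
  flow_zero : ∀ s, flow s 0 = s
  flow_flow : ∀ s t t', flow (flow s t) t' = flow s (t + t')

/-- The orbit of a state. -/
def DynSystem.orbit {T : Type w} [AddMonoid T] {S : Type v} (D : DynSystem T S) (s : S) :
    Set S :=
  Set.range (D.flow s)

/-- The frame `F` corresponds to the orbit coalgebra of the system `D` on the set of worlds:
its accessibility relation is reachability in `D`. -/
def KripkeFrame.IsOrbitFrameOf (F : KripkeFrame.{v}) {T : Type w} [AddMonoid T]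
    (D : DynSystem T F.World) : Prop :=
  ∀ x y : F.World, F.Rel x y ↔ y ∈ D.orbit x

/-- Orbital frames. The universe `w` is that of the time monoid. -/
def orbitalFrames : Set KripkeFrame.{v} :=
  {F | ∃ (T : Type w) (_ : AddMonoid T) (D : DynSystem T F.World), F.IsOrbitFrameOf D}

def linearTimeOrbitalFrames : Set KripkeFrame.{v} :=
  {F | ∃ (T : Type w) (_ : AddMonoid T) (D : DynSystem T F.World),
    LinearTime T ∧ F.IsOrbitFrameOf D}

def invertibleOrbitalFrames : Set KripkeFrame.{v} :=
  {F | ∃ (T : Type w) (_ : AddMonoid T) (D : DynSystem T F.World),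
    SymmetricTime T ∧ F.IsOrbitFrameOf D}

open ModalFormula

/-! Soundness -/

section Soundness

variable {α : Type u}

/-! Soundness is frame correspondence: the zero of time makes reachability reflexive, addition makes
it transitive, linear time makes any two successors of a state comparable, and invertible time makes
reachability Euclidean.

For completeness, a non-theorem fails in a finite filtration of the part of the canonical model seen
from one world `w₀` (`exists_filtrationModel_not_sat`). Its relation is a preorder, total for S4.3
and universal for S5. Each such finite frame is the image of an orbit frame under a surjective
bounded morphism, which preserves satisfaction. For S4 the system is the monoid of all inflationary
maps acting on the frame; for S5 it is a cyclic group translating itself; for S4.3 it is the ordinal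
`ω²` acting on itself by addition, each block of length `ω` visiting one cluster again and again. -/

theorem KripkeFrame.valid_of_normalTheorem {F : KripkeFrame.{v}} {Ax : Set (ModalFormula α)}
    (h : ∀ A ∈ Ax, F.Valid A) {A : ModalFormula α} (hA : NormalTheorem Ax A) : F.Valid A := by
  intro M
  induction hA with
  | ax hA => exact h _ hA M
  | weaken A B => intro x; simp only [KripkeModel.Sat]; tauto
  | frege A B C => intro x; simp only [KripkeModel.Sat]; tauto
  | contrapose A B => intro x; simp only [KripkeModel.Sat]; tauto
  | distribution A B =>
    intro x
    simp only [KripkeModel.Sat]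
    by_contra hn
    push Not at hn
    obtain ⟨h1, h2, y, hy, h3⟩ := hn
    exact (h1 y hy).elim (fun h => h (h2 y hy)) h3
  | modusPonens _ _ ih1 ih2 => intro x; exact (ih1 x).resolve_left (not_not_intro (ih2 x))
  | necessitation _ ih => intro x y _; exact ih y

theorem KripkeFrame.valid_axiomsT {F : KripkeFrame.{v}} (hr : ∀ x, F.Rel x x)
    {A : ModalFormula α} (hA : A ∈ axiomsT α) : F.Valid A := by
  obtain ⟨A, rfl⟩ := hA
  intro M x
  simp only [KripkeModel.Sat]
  by_cases h : M.Sat x A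
  · exact Or.inr h
  · exact Or.inl fun h' => h (h' x (hr x))

theorem KripkeFrame.valid_axioms4 {F : KripkeFrame.{v}}
    (ht : ∀ x y z, F.Rel x y → F.Rel y z → F.Rel x z)
    {A : ModalFormula α} (hA : A ∈ axioms4 α) : F.Valid A := by
  obtain ⟨A, rfl⟩ := hA
  intro M x
  simp only [KripkeModel.Sat]
  rw [← imp_iff_not_or]
  exact fun h y hy z hz => h z (ht x y z hy hz)

theorem KripkeFrame.valid_axioms3 {F : KripkeFrame.{v}}
    (hc : ∀ x y z, F.Rel x y → F.Rel x z → F.Rel y z ∨ F.Rel z y)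
    {A : ModalFormula α} (hA : A ∈ axioms3 α) : F.Valid A := by
  obtain ⟨A, B, rfl⟩ := hA
  intro M x
  simp only [disj, KripkeModel.Sat]
  by_contra hn
  push Not at hn
  obtain ⟨⟨y, hy, hyA, hyB⟩, z, hz, hzB, hzA⟩ := hn
  rcases hc x y z hy hz with h | h
  · exact hzA (hyA z h)
  · exact hyB (hzB y h)

theorem KripkeFrame.valid_axioms5 {F : KripkeFrame.{v}}
    (he : ∀ x y z, F.Rel x y → F.Rel x z → F.Rel y z)
    {A : ModalFormula α} (hA : A ∈ axioms5 α) : F.Valid A := by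
  obtain ⟨A, rfl⟩ := hA
  intro M x
  simp only [dia, KripkeModel.Sat]
  rw [← imp_iff_not_or]
  intro h y hy h'
  exact h fun z hz => h' z (he x y z hy hz)

/-! ### Frame conditions satisfied by reachability -/

section Orbit

variable {T : Type w} [AddMonoid T] {F : KripkeFrame.{v}} {D : DynSystem T F.World}

theorem KripkeFrame.IsOrbitFrameOf.refl (h : F.IsOrbitFrameOf D) (x : F.World) : F.Rel x x :=
  (h x x).2 ⟨0, D.flow_zero x⟩

theorem KripkeFrame.IsOrbitFrameOf.trans (h : F.IsOrbitFrameOf D) (x y z : F.World)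
    (hxy : F.Rel x y) (hyz : F.Rel y z) : F.Rel x z := by
  obtain ⟨a, rfl⟩ := (h _ _).1 hxy
  obtain ⟨b, rfl⟩ := (h _ _).1 hyz
  exact (h _ _).2 ⟨a + b, (D.flow_flow x a b).symm⟩

theorem KripkeFrame.IsOrbitFrameOf.rel_flow (h : F.IsOrbitFrameOf D) (x : F.World) {a b : T}
    (hab : MonoidLE T a b) : F.Rel (D.flow x a) (D.flow x b) := by
  obtain ⟨c, rfl⟩ := hab
  exact (h _ _).2 ⟨c, D.flow_flow x a c⟩

theorem KripkeFrame.IsOrbitFrameOf.connected (h : F.IsOrbitFrameOf D) (hT : LinearTime T)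
    (x y z : F.World) (hxy : F.Rel x y) (hxz : F.Rel x z) : F.Rel y z ∨ F.Rel z y := by
  obtain ⟨a, rfl⟩ := (h _ _).1 hxy
  obtain ⟨b, rfl⟩ := (h _ _).1 hxz
  exact (hT a b).imp (h.rel_flow x) (h.rel_flow x)

theorem KripkeFrame.IsOrbitFrameOf.euclidean (h : F.IsOrbitFrameOf D) (hT : SymmetricTime T)
    (x y z : F.World) (hxy : F.Rel x y) (hxz : F.Rel x z) : F.Rel y z := by
  obtain ⟨a, rfl⟩ := (h _ _).1 hxy
  -- Always `0 ≤ a`, so invertibility gives `a ≤ 0`: the flow returns from `y` to `x`.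
  have h0 := h.rel_flow x (hT 0 a ⟨a, zero_add a⟩)
  rw [D.flow_zero] at h0
  exact h.trans _ _ _ h0 hxz

end Orbit

theorem soundFor_logicS4 : SoundFor (logicS4 α) orbitalFrames.{v, w} := by
  rintro A hA F ⟨T, _, D, hD⟩
  refine F.valid_of_normalTheorem ?_ hA
  rintro B (hB | hB)
  · exact F.valid_axiomsT hD.refl hB
  · exact F.valid_axioms4 hD.trans hB

theorem soundFor_logicS43 : SoundFor (logicS43 α) linearTimeOrbitalFrames.{v, w} := by
  rintro A hA F ⟨T, _, D, hT, hD⟩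
  refine F.valid_of_normalTheorem ?_ hA
  rintro B ((hB | hB) | hB)
  · exact F.valid_axiomsT hD.refl hB
  · exact F.valid_axioms4 hD.trans hB
  · exact F.valid_axioms3 (hD.connected hT) hB

theorem soundFor_logicS5 : SoundFor (logicS5 α) invertibleOrbitalFrames.{v, w} := by
  rintro A hA F ⟨T, _, D, hT, hD⟩
  refine F.valid_of_normalTheorem ?_ hA
  rintro B ((hB | hB) | hB)
  · exact F.valid_axiomsT hD.refl hB
  · exact F.valid_axioms4 hD.trans hB
  · exact F.valid_axioms5 (hD.euclidean hT) hB

end Soundness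

/-! Theories and the canonical model -/

section Theories

variable {α : Type u} {Ax : Set (ModalFormula α)}

/-- A set of formulas that contains the logic of `Ax` and is closed under modus ponens. -/
structure IsTheory (Ax w : Set (ModalFormula α)) : Prop where
  thm : ∀ {A}, NormalTheorem Ax A → A ∈ w
  mp : ∀ {A B}, imp A B ∈ w → A ∈ w → B ∈ w

theorem isTheory_normalTheorem : IsTheory Ax {A | NormalTheorem Ax A} :=
  ⟨id, .modusPonens⟩

namespace IsTheory

variable {w : Set (ModalFormula α)} {A B C : ModalFormula α}

theorem imp_of_mem (hw : IsTheory Ax w) (h : B ∈ w) : imp A B ∈ w :=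
  hw.mp (hw.thm (.weaken B A)) h

theorem imp_self (hw : IsTheory Ax w) (A : ModalFormula α) : imp A A ∈ w :=
  hw.mp (hw.mp (hw.thm (.frege A (imp A A) A)) (hw.thm (.weaken A (imp A A))))
    (hw.thm (.weaken A A))

/-- The theory generated by `w` and `A`. -/
theorem adjoin (hw : IsTheory Ax w) (A : ModalFormula α) : IsTheory Ax {B | imp A B ∈ w} :=
  ⟨fun h => hw.imp_of_mem (hw.thm h), fun {B C} h1 h2 =>
    hw.mp (hw.mp (hw.thm (.frege A B C)) h1) h2⟩

theorem explosion (hw : IsTheory Ax w) (h : neg A ∈ w) (h' : A ∈ w) : B ∈ w :=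
  hw.mp (hw.mp (hw.thm (.contrapose B A)) (hw.imp_of_mem h)) h'

theorem neg_neg_imp (hw : IsTheory Ax w) (A : ModalFormula α) : imp (neg (neg A)) A ∈ w := by
  have ht := hw.adjoin (neg (neg A))
  have h : neg (neg A) ∈ {B | imp (neg (neg A)) B ∈ w} := hw.imp_self _
  have h1 := ht.mp (ht.thm (.contrapose (neg (neg (neg A))) (neg A))) (ht.imp_of_mem h)
  exact ht.mp (ht.mp (ht.thm (.contrapose A (neg (neg A)))) h1) h

theorem imp_neg_neg (hw : IsTheory Ax w) (A : ModalFormula α) : imp A (neg (neg A)) ∈ w :=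
  hw.mp (hw.thm (.contrapose (neg (neg A)) A)) (hw.neg_neg_imp (neg A))

theorem imp_trans (hw : IsTheory Ax w) (h : imp A B ∈ w) (h' : imp B C ∈ w) : imp A C ∈ w :=
  (hw.adjoin A).mp (hw.imp_of_mem h') h

/-- Under `¬A` the hypothesis is contradictory, so it yields even the negation of the theorem `A →
A`; contraposition then gives `A`. -/
theorem mem_of_neg_imp_self (hw : IsTheory Ax w) (h : imp (neg A) A ∈ w) : A ∈ w := by
  have h1 : imp (neg A) (neg (imp A A)) ∈ w := (hw.adjoin (neg A)).explosion (hw.imp_self _) h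
  exact hw.mp (hw.mp (hw.thm (.contrapose A (imp A A))) h1) (hw.imp_self A)

theorem mem_of_cases (hw : IsTheory Ax w) (h : imp B A ∈ w) (h' : imp (neg B) A ∈ w) :
    A ∈ w := by
  have h1 : imp (neg (neg B)) (neg (neg A)) ∈ w :=
    hw.imp_trans (hw.imp_trans (hw.neg_neg_imp B) h) (hw.imp_neg_neg A)
  exact hw.mem_of_neg_imp_self (hw.imp_trans (hw.mp (hw.thm (.contrapose _ _)) h1) h')

/-- Necessitation and distribution are exactly what is needed. Extending this theory to a complete
one produces canonical successors of `w`. -/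
theorem unbox (hw : IsTheory Ax w) : IsTheory Ax {A | box A ∈ w} :=
  ⟨fun h => hw.thm (.necessitation h), fun h1 h2 =>
    hw.mp (hw.mp (hw.thm (.distribution _ _)) h1) h2⟩

end IsTheory

/-- Complete consistent theories: the worlds of the canonical model. -/
structure IsCanonicalWorld (Ax w : Set (ModalFormula α)) : Prop extends IsTheory Ax w where
  neg_mem_iff : ∀ {A}, neg A ∈ w ↔ A ∉ w

/-- Lindenbaum's lemma: by Zorn, take a theory maximal among those omitting `A`. -/
theorem IsTheory.exists_canonicalWorld {t : Set (ModalFormula α)} (ht : IsTheory Ax t)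
    {A : ModalFormula α} (hA : A ∉ t) : ∃ w, IsCanonicalWorld Ax w ∧ t ⊆ w ∧ A ∉ w := by
  obtain ⟨w, htw, hmax⟩ := zorn_subset_nonempty {w | IsTheory Ax w ∧ A ∉ w} (by
    intro c hc hchain hne
    obtain ⟨s₀, hs₀⟩ := hne
    refine ⟨⋃₀ c, ⟨⟨fun h => ⟨s₀, hs₀, (hc hs₀).1.thm h⟩, ?_⟩, ?_⟩,
      fun s hs => Set.subset_sUnion_of_mem hs⟩
    · rintro B C ⟨s, hs, hBC⟩ ⟨s', hs', hB⟩
      rcases hchain.total hs hs' with h | h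
      · exact ⟨s', hs', (hc hs').1.mp (h hBC) hB⟩
      · exact ⟨s, hs, (hc hs).1.mp hBC (h hB)⟩
    · rintro ⟨s, hs, h⟩
      exact (hc hs).2 h) t ⟨ht, hA⟩
  obtain ⟨hw, hAw⟩ := hmax.prop
  -- Otherwise the theory generated by `w` and `B` would still omit `A`, against maximality.
  have key : ∀ B, B ∉ w → imp B A ∈ w := by
    intro B hB
    by_contra h
    exact hB (hmax.le_of_ge (y := {C | imp B C ∈ w}) ⟨hw.adjoin B, h⟩
      (fun C hC => hw.imp_of_mem hC) (hw.imp_self B))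
  refine ⟨w, ⟨hw, fun {B} => ⟨fun h h' => hAw (hw.explosion h h'), fun h => ?_⟩⟩, htw, hAw⟩
  by_contra h'
  exact hAw (hw.mem_of_cases (key B h) (key _ h'))

namespace IsCanonicalWorld

variable {w : Set (ModalFormula α)} {A B : ModalFormula α}

theorem imp_mem_iff (hw : IsCanonicalWorld Ax w) : imp A B ∈ w ↔ A ∉ w ∨ B ∈ w := by
  constructor
  · intro h
    by_cases hA : A ∈ w
    · exact Or.inr (hw.mp h hA)
    · exact Or.inl hA
  · rintro (h | h)
    · exact (hw.adjoin A).explosion (hw.imp_of_mem (hw.neg_mem_iff.2 h)) (hw.imp_self A)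
    · exact hw.imp_of_mem h

theorem exists_notMem_of_box_notMem (hw : IsCanonicalWorld Ax w) (h : box A ∉ w) :
    ∃ v, IsCanonicalWorld Ax v ∧ {B | box B ∈ w} ⊆ v ∧ A ∉ v :=
  hw.unbox.exists_canonicalWorld h

theorem mem_of_box_mem (hw : IsCanonicalWorld Ax w) (hT : axiomsT α ⊆ Ax) (h : box A ∈ w) :
    A ∈ w :=
  hw.mp (hw.thm (.ax (hT ⟨A, rfl⟩))) h

theorem box_box_mem (hw : IsCanonicalWorld Ax w) (h4 : axioms4 α ⊆ Ax) (h : box A ∈ w) :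
    box (box A) ∈ w :=
  hw.mp (hw.thm (.ax (h4 ⟨A, rfl⟩))) h

/-- If `C` and `D` witness the two failures, the axiom for `C`, `D` at `w` puts `□C → D` in `v` or
`□D → C` in `v'`, and either is contradictory. -/
theorem unbox_subset_total {v v' : Set (ModalFormula α)} (hw : IsCanonicalWorld Ax w)
    (hv : IsCanonicalWorld Ax v) (hv' : IsCanonicalWorld Ax v') (h3 : axioms3 α ⊆ Ax)
    (h : {B | box B ∈ w} ⊆ v) (h' : {B | box B ∈ w} ⊆ v') :
    {B | box B ∈ v} ⊆ v' ∨ {B | box B ∈ v'} ⊆ v := by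
  by_contra hn
  simp only [not_or, Set.not_subset] at hn
  obtain ⟨⟨C, hC, hC'⟩, D, hD, hD'⟩ := hn
  have hax := hw.thm (.ax (h3 ⟨C, D, rfl⟩))
  rw [disj, hw.imp_mem_iff, hw.neg_mem_iff, not_not] at hax
  rcases hax with h1 | h1
  · exact hD' (hv.mp (h h1) hC)
  · exact hC' (hv'.mp (h' h1) hD)

/-- If `□A ∉ w`, then `◇¬A ∈ w`, so `□◇¬A ∈ w` and `◇¬A ∈ v`, contradicting `□A ∈ v`. -/
theorem box_mem_of_box_mem_of_axioms5 {v : Set (ModalFormula α)} (hw : IsCanonicalWorld Ax w)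
    (hv : IsCanonicalWorld Ax v) (h5 : axioms5 α ⊆ Ax) (h : {B | box B ∈ w} ⊆ v)
    (hA : box A ∈ v) : box A ∈ w := by
  by_contra hn
  have h1 : dia (neg A) ∈ w :=
    hw.neg_mem_iff.2 fun h1 => hn (hw.unbox.mp (hw.unbox.neg_neg_imp A) h1)
  have h2 : dia (neg A) ∈ v := h (hw.mp (hw.thm (.ax (h5 ⟨neg A, rfl⟩))) h1)
  exact hv.neg_mem_iff.1 h2 (hv.unbox.mp (hv.unbox.imp_neg_neg A) hA)

end IsCanonicalWorld

end Theories

/-! Filtration -/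

section Filtration

variable {α : Type u} {Ax : Set (ModalFormula α)}

/-- The subformulas of a formula. -/
def ModalFormula.subformulas : ModalFormula α → Set (ModalFormula α)
  | .atom p => {.atom p}
  | .neg A => insert (neg A) A.subformulas
  | .imp A B => insert (imp A B) (A.subformulas ∪ B.subformulas)
  | .box A => insert (box A) A.subformulas

namespace ModalFormula

theorem finite_subformulas (A : ModalFormula α) : A.subformulas.Finite := by
  induction A with
  | atom p => exact Set.finite_singleton _
  | neg A ih => exact ih.insert _
  | imp A B ihA ihB => exact (ihA.union ihB).insert _
  | box A ih => exact ih.insert _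

theorem self_mem_subformulas (A : ModalFormula α) : A ∈ A.subformulas := by
  cases A <;> simp [subformulas]

theorem subformulas_subset {A B : ModalFormula α} (h : B ∈ A.subformulas) :
    B.subformulas ⊆ A.subformulas := by
  induction A with
  | atom p => rw [Set.mem_singleton_iff.1 h]
  | neg A ih =>
    rcases h with rfl | h
    · rfl
    · exact (ih h).trans (Set.subset_insert _ _)
  | imp A C ihA ihC =>
    rcases h with rfl | h | h
    · rfl
    · exact (ihA h).trans (Set.subset_union_left.trans (Set.subset_insert _ _))
    · exact (ihC h).trans (Set.subset_union_right.trans (Set.subset_insert _ _))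
  | box A ih =>
    rcases h with rfl | h
    · rfl
    · exact (ih h).trans (Set.subset_insert _ _)

end ModalFormula

/-- The canonical worlds accessible from `w₀`, identified when they agree on the subformulas of
`A`, and related by preservation of boxed subformulas of `A`. -/
def filtrationFrame (Ax w₀ : Set (ModalFormula α)) (A : ModalFormula α) : KripkeFrame.{u} where
  World := {s : Set A.subformulas //
    ∃ w, IsCanonicalWorld Ax w ∧ {B | box B ∈ w₀} ⊆ w ∧ s = Subtype.val ⁻¹' w}
  Rel s t := ∀ (B : ModalFormula α) (h : box B ∈ A.subformulas),
    (⟨box B, h⟩ : A.subformulas) ∈ s.1 → (⟨box B, h⟩ : A.subformulas) ∈ t.1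

def filtrationModel (Ax w₀ : Set (ModalFormula α)) (A : ModalFormula α) :
    KripkeModel α (filtrationFrame Ax w₀ A) where
  val s p := ∃ h : atom p ∈ A.subformulas, (⟨atom p, h⟩ : A.subformulas) ∈ s.1

instance (w₀ : Set (ModalFormula α)) (A : ModalFormula α) :
    Finite (filtrationFrame Ax w₀ A).World :=
  have : Finite A.subformulas := A.finite_subformulas
  inferInstanceAs (Finite (Subtype (α := Set A.subformulas) _))

variable {w₀ : Set (ModalFormula α)} {A : ModalFormula α}

/-- The truth lemma. The filtered relation preserves `□B`, not merely `B`, which makes it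
transitive. Axiom 4 shows that canonical successors are related in this sense and remain accessible
from `w₀`; axiom T recovers `B` from `□B`. -/
theorem filtrationModel_sat_iff (hT : axiomsT α ⊆ Ax) (h4 : axioms4 α ⊆ Ax)
    (hw₀ : IsCanonicalWorld Ax w₀) (B : ModalFormula α) (hB : B ∈ A.subformulas)
    (s : (filtrationFrame Ax w₀ A).World) :
    (filtrationModel Ax w₀ A).Sat s B ↔ (⟨B, hB⟩ : A.subformulas) ∈ s.1 := by
  induction B generalizing s with
  | atom p => exact ⟨fun ⟨_, h⟩ => h, fun h => ⟨hB, h⟩⟩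
  | neg B ih =>
    have hB' : B ∈ A.subformulas :=
      subformulas_subset hB (Set.mem_insert_of_mem _ B.self_mem_subformulas)
    obtain ⟨_, w, hw, -, rfl⟩ := s
    exact (not_congr (ih hB' _)).trans hw.neg_mem_iff.symm
  | imp B C ihB ihC =>
    have hB' : B ∈ A.subformulas :=
      subformulas_subset hB (Set.mem_insert_of_mem _ (Or.inl B.self_mem_subformulas))
    have hC' : C ∈ A.subformulas :=
      subformulas_subset hB (Set.mem_insert_of_mem _ (Or.inr C.self_mem_subformulas))
    obtain ⟨_, w, hw, -, rfl⟩ := s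
    exact (or_congr (not_congr (ihB hB' _)) (ihC hC' _)).trans hw.imp_mem_iff.symm
  | box B ih =>
    have hB' : B ∈ A.subformulas :=
      subformulas_subset hB (Set.mem_insert_of_mem _ B.self_mem_subformulas)
    simp only [KripkeModel.Sat, ih hB']
    constructor
    · intro h
      obtain ⟨_, w, hw, hw₀w, rfl⟩ := s
      by_contra hn
      obtain ⟨v, hv, hwv, hBv⟩ := hw.exists_notMem_of_box_notMem hn
      exact hBv (h ⟨_, v, hv, fun C hC => hwv (hw₀w (hw₀.box_box_mem h4 hC)), rfl⟩
        fun C _ hC => hwv (hw.box_box_mem h4 hC))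
    · intro h t hst
      have ht := hst B hB h
      obtain ⟨v, hv, -, htv⟩ := t.2
      rw [htv] at ht ⊢
      exact hv.mem_of_box_mem hT ht

theorem exists_filtrationModel_not_sat (hT : axiomsT α ⊆ Ax) (h4 : axioms4 α ⊆ Ax)
    (hA : ¬ NormalTheorem Ax A) : ∃ w₀, IsCanonicalWorld Ax w₀ ∧
      ∃ s, ¬ (filtrationModel Ax w₀ A).Sat s A := by
  obtain ⟨w₀, hw₀, -, hA'⟩ := isTheory_normalTheorem.exists_canonicalWorld hA
  refine ⟨w₀, hw₀, ⟨_, w₀, hw₀, fun B hB => hw₀.mem_of_box_mem hT hB, rfl⟩, ?_⟩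
  exact fun h => hA' ((filtrationModel_sat_iff hT h4 hw₀ A A.self_mem_subformulas _).1 h)

theorem filtrationFrame_rel_refl (s : (filtrationFrame Ax w₀ A).World) :
    (filtrationFrame Ax w₀ A).Rel s s := fun _ _ h => h

theorem filtrationFrame_rel_trans {s t r : (filtrationFrame Ax w₀ A).World}
    (h : (filtrationFrame Ax w₀ A).Rel s t) (h' : (filtrationFrame Ax w₀ A).Rel t r) :
    (filtrationFrame Ax w₀ A).Rel s r := fun B hB hs => h' B hB (h B hB hs)

theorem filtrationFrame_rel_total (h4 : axioms4 α ⊆ Ax) (h3 : axioms3 α ⊆ Ax)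
    (hw₀ : IsCanonicalWorld Ax w₀) (s t : (filtrationFrame Ax w₀ A).World) :
    (filtrationFrame Ax w₀ A).Rel s t ∨ (filtrationFrame Ax w₀ A).Rel t s := by
  obtain ⟨_, w, hw, hw₀w, rfl⟩ := s
  obtain ⟨_, v, hv, hw₀v, rfl⟩ := t
  exact (hw₀.unbox_subset_total hw hv h3 hw₀w hw₀v).imp
    (fun h _ _ hB => h (hw.box_box_mem h4 hB)) (fun h _ _ hB => h (hv.box_box_mem h4 hB))

/-- A box true at `s` travels back to `w₀` by axiom 5, then forward to `t` by axiom 4. -/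
theorem filtrationFrame_rel_univ (h4 : axioms4 α ⊆ Ax) (h5 : axioms5 α ⊆ Ax)
    (hw₀ : IsCanonicalWorld Ax w₀) (s t : (filtrationFrame Ax w₀ A).World) :
    (filtrationFrame Ax w₀ A).Rel s t := by
  obtain ⟨_, w, hw, hw₀w, rfl⟩ := s
  obtain ⟨_, v, hv, hw₀v, rfl⟩ := t
  exact fun B _ hB =>
    hw₀v (hw₀.box_box_mem h4 (hw₀.box_mem_of_box_mem_of_axioms5 hw h5 hw₀w hB))

end Filtration

/-! Bounded morphisms from orbit frames -/

section BoundedMorphism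

variable {α : Type u}

theorem KripkeModel.sat_iff_of_bounded_morphism {F : KripkeFrame.{v}} {G : KripkeFrame.{w}}
    (N : KripkeModel α G) (g : F.World → G.World)
    (forth : ∀ x y, F.Rel x y → G.Rel (g x) (g y))
    (back : ∀ x s, G.Rel (g x) s → ∃ y, F.Rel x y ∧ g y = s)
    (A : ModalFormula α) (x : F.World) :
    (KripkeModel.mk fun y => N.val (g y)).Sat x A ↔ N.Sat (g x) A := by
  induction A generalizing x with
  | atom p => rfl
  | neg A ih => simp only [KripkeModel.Sat, ih]
  | imp A B ihA ihB => simp only [KripkeModel.Sat, ihA, ihB]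
  | box A ih =>
    simp only [KripkeModel.Sat, ih]
    constructor
    · intro h s hs
      obtain ⟨y, hy, rfl⟩ := back x s hs
      exact h y hy
    · exact fun h y hy => h _ (forth x y hy)

/-- A surjective bounded morphism from the orbit frame of `D` onto `G`. -/
structure DynSystem.CoversFrame {T : Type} [AddMonoid T] {S : Type} (D : DynSystem T S)
    (G : KripkeFrame.{u}) (g : S → G.World) : Prop where
  surj : Function.Surjective g
  forth : ∀ x t, G.Rel (g x) (g (D.flow x t))
  back : ∀ x s, G.Rel (g x) s → ∃ t, g (D.flow x t) = s

/-- A dynamical system lifted to larger universes. -/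
def DynSystem.uliftSystem {T : Type} [AddMonoid T] {S : Type} (D : DynSystem T S) :
    DynSystem (ULift.{w} T) (ULift.{v} S) where
  flow s t := ⟨D.flow s.down t.down⟩
  flow_zero s := ULift.ext _ _ (D.flow_zero s.down)
  flow_flow s t t' := ULift.ext _ _ (D.flow_flow s.down t.down t'.down)

/-- Filtrations live in the universe of `α`, unrelated to those of the frame classes. Being finite,
they have covers in `Type`, which lift to any universe. -/
def DynSystem.uliftFrame {T : Type} [AddMonoid T] {S : Type} (D : DynSystem T S) :
    KripkeFrame.{v} where
  World := ULift.{v} S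
  Rel x y := ∃ t, D.flow x.down t = y.down

theorem DynSystem.isOrbitFrameOf_uliftSystem {T : Type} [AddMonoid T] {S : Type}
    (D : DynSystem T S) :
    D.uliftFrame.IsOrbitFrameOf (DynSystem.uliftSystem.{v, w} D) := fun _ _ =>
  ⟨fun ⟨t, ht⟩ => ⟨⟨t⟩, ULift.ext _ _ ht⟩, fun ⟨t, ht⟩ => ⟨t.down, congrArg ULift.down ht⟩⟩

theorem MonoidLE.ulift {T : Type} [AddMonoid T] {a b : T} (h : MonoidLE T a b) :
    MonoidLE (ULift.{w} T) ⟨a⟩ ⟨b⟩ := by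
  obtain ⟨c, rfl⟩ := h
  exact ⟨⟨c⟩, rfl⟩

theorem MonoidLE.of_ulift {T : Type} [AddMonoid T] {a b : ULift.{w} T}
    (h : MonoidLE (ULift.{w} T) a b) : MonoidLE T a.down b.down := by
  obtain ⟨c, rfl⟩ := h
  exact ⟨c.down, rfl⟩

theorem LinearTime.ulift {T : Type} [AddMonoid T] (h : LinearTime T) :
    LinearTime (ULift.{w} T) := fun a b =>
  (h a.down b.down).imp MonoidLE.ulift MonoidLE.ulift

theorem SymmetricTime.ulift {T : Type} [AddMonoid T] (h : SymmetricTime T) :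
    SymmetricTime (ULift.{w} T) := fun _ _ hab => (h _ _ hab.of_ulift).ulift

theorem DynSystem.CoversFrame.sat_of_valid {T : Type} [AddMonoid T] {S : Type}
    {D : DynSystem T S} {G : KripkeFrame.{u}} {g : S → G.World} (hg : D.CoversFrame G g)
    {A : ModalFormula α} (h : (DynSystem.uliftFrame.{v} D).Valid A) (N : KripkeModel α G)
    (s : G.World) : N.Sat s A := by
  obtain ⟨x, rfl⟩ := hg.surj s
  refine (N.sat_iff_of_bounded_morphism (F := DynSystem.uliftFrame.{v} D)
    (fun y => g y.down) ?_ ?_ A ⟨x⟩).1 (h _ _)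
  · rintro x y ⟨t, ht⟩
    rw [← ht]
    exact hg.forth _ t
  · intro x s hs
    obtain ⟨t, ht⟩ := hg.back _ s hs
    exact ⟨⟨D.flow x.down t⟩, ⟨t, rfl⟩, ht⟩

end BoundedMorphism

/-! Finite preorders as orbit frames -/

section Inflationary

variable {S : Type}

/-- The self-maps of `S` that move every point along `R`. -/
def InflationaryMap (R : S → S → Prop) : Type := {f : S → S // ∀ x, R x (f x)}

/-- Inflationary maps under composition in diagrammatic order. -/
abbrev InflationaryMap.addMonoid (R : S → S → Prop) [Std.Refl R] [IsTrans S R] :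
    AddMonoid (InflationaryMap R) where
  add f g := ⟨g.1 ∘ f.1, fun x => _root_.trans (f.2 x) (g.2 (f.1 x))⟩
  zero := ⟨id, fun x => refl x⟩
  add_assoc _ _ _ := rfl
  zero_add _ := rfl
  add_zero _ := rfl
  nsmul := @nsmulRec _ ⟨⟨id, fun x => refl x⟩⟩
    ⟨fun f g => ⟨g.1 ∘ f.1, fun x => _root_.trans (f.2 x) (g.2 (f.1 x))⟩⟩

theorem exists_coversFrame_of_preorder (G : KripkeFrame.{u}) [Finite G.World]
    (hr : ∀ s, G.Rel s s) (ht : ∀ s t r, G.Rel s t → G.Rel t r → G.Rel s r) :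
    ∃ (T S : Type) (_ : AddMonoid T) (D : DynSystem T S) (g : S → G.World),
      D.CoversFrame G g := by
  classical
  obtain ⟨n, ⟨e⟩⟩ := Finite.exists_equiv_fin G.World
  let R : Fin n → Fin n → Prop := fun i j => G.Rel (e.symm i) (e.symm j)
  have : Std.Refl R := ⟨fun i => hr _⟩
  have : IsTrans (Fin n) R := ⟨fun i j k => ht _ _ _⟩
  let := InflationaryMap.addMonoid R
  let D : DynSystem (InflationaryMap R) (Fin n) :=
    ⟨fun i f => f.1 i, fun _ => rfl, fun _ _ _ => rfl⟩
  refine ⟨_, _, _, D, e.symm, e.symm.surjective, fun i f => f.2 i, fun i s hs => ?_⟩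
  -- Moving `i` alone to the desired successor is inflationary, by reflexivity at the other points.
  refine ⟨⟨Function.update id i (e s), fun j => ?_⟩, ?_⟩
  · by_cases h : j = i
    · subst h
      simpa [R] using hs
    · simpa [R, h] using hr _
  · simp [D]

end Inflationary

/-! ### Finite universal frames as orbit frames -/

section Universal

theorem exists_coversFrame_of_univ (G : KripkeFrame.{u}) [Finite G.World] [Nonempty G.World]
    (h : ∀ s t, G.Rel s t) :
    ∃ (T S : Type) (_ : AddMonoid T) (D : DynSystem T S) (g : S → G.World),
      SymmetricTime T ∧ D.CoversFrame G g := by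
  obtain ⟨n, ⟨e⟩⟩ := Finite.exists_equiv_fin G.World
  have : NeZero n := ⟨by rintro rfl; exact (e (Classical.arbitrary _)).elim0⟩
  let D : DynSystem (Fin n) (Fin n) :=
    ⟨fun s t => s + t, add_zero, add_assoc⟩
  refine ⟨Fin n, Fin n, inferInstance, D, e.symm, ?_, e.symm.surjective, fun _ _ => h _ _,
    fun i s _ => ⟨e s - i, ?_⟩⟩
  · exact fun a b _ => ⟨a - b, by abel⟩
  · simp [D]

end Universal

/-! Linear time -/

section LinearTime

/-- The ordinals below `ω²`, written as `ω * blocks + offset`. -/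
@[ext]
structure OmegaSq : Type where
  blocks : ℕ
  offset : ℕ

namespace OmegaSq

instance : Zero OmegaSq := ⟨⟨0, 0⟩⟩

/-- Ordinal addition: a nonzero number of blocks on the right absorbs the offset on the left. -/
instance : Add OmegaSq :=
  ⟨fun a b => ⟨a.blocks + b.blocks, if b.blocks = 0 then a.offset + b.offset else b.offset⟩⟩

theorem add_def (a b : OmegaSq) : a + b =
    ⟨a.blocks + b.blocks, if b.blocks = 0 then a.offset + b.offset else b.offset⟩ := rfl

theorem zero_def : (0 : OmegaSq) = ⟨0, 0⟩ := rfl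

instance : AddMonoid OmegaSq where
  add_assoc a b c := by
    ext
    · simp [add_def, add_assoc]
    · simp only [add_def]
      split_ifs <;> omega
  zero_add a := by simp [add_def, zero_def]
  add_zero a := by simp [add_def, zero_def]
  nsmul := nsmulRec

theorem monoidLE_iff {a b : OmegaSq} : MonoidLE OmegaSq a b ↔
    a.blocks < b.blocks ∨ a.blocks = b.blocks ∧ a.offset ≤ b.offset := by
  constructor
  · rintro ⟨c, rfl⟩
    simp only [add_def]
    split_ifs <;> omega
  · rintro (h | ⟨h, h'⟩)
    · refine ⟨⟨b.blocks - a.blocks, b.offset⟩, ?_⟩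
      ext
      · simp only [add_def]; omega
      · simp only [add_def]; split_ifs <;> omega
    · refine ⟨⟨0, b.offset - a.offset⟩, ?_⟩
      ext <;> simp only [add_def, if_true] <;> omega

theorem linearTime : LinearTime OmegaSq := fun a b => by
  simp only [monoidLE_iff]
  omega

end OmegaSq

theorem exists_surjective_rank (V : Type u) [Preorder V] [Finite V]
    [Std.Total (α := V) (· ≤ ·)] :
    ∃ (n : ℕ) (ρ : V → Fin n), Function.Surjective ρ ∧ ∀ v w, ρ v ≤ ρ w ↔ v ≤ w := by
  classical
  have : Fintype (Antisymmetrization V (· ≤ ·)) :=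
    @Fintype.ofFinite _ (inferInstanceAs (Finite (Quotient _)))
  let e := monoEquivOfFin (Antisymmetrization V (· ≤ ·)) rfl
  refine ⟨_, fun v => e.symm (toAntisymmetrization (· ≤ ·) v),
    e.symm.surjective.comp Quotient.mk_surjective, fun v w => ?_⟩
  rw [e.symm.le_iff_le, toAntisymmetrization_le_toAntisymmetrization_iff]

theorem exists_monotone_enumeration (V : Type u) [Preorder V] [Finite V] [Nonempty V]
    [Std.Total (α := V) (· ≤ ·)] :
    ∃ x : ℕ → V, Monotone x ∧ ∀ v, ∃ i, v ≤ x i ∧ x i ≤ v := by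
  obtain ⟨n, ρ, hρ, hle⟩ := exists_surjective_rank V
  have hn : 0 < n := (ρ (Classical.arbitrary V)).pos
  choose σ hσ using hρ
  -- One representative per cluster in increasing order, with the top one repeated forever.
  refine ⟨fun i => σ ⟨min i (n - 1), by omega⟩, fun i j hij => ?_, fun v => ⟨ρ v, ?_⟩⟩
  · rw [← hle, hσ, hσ, Fin.mk_le_mk]
    omega
  · have hv : (⟨min (ρ v : ℕ) (n - 1), by omega⟩ : Fin n) = ρ v :=
      Fin.ext (min_eq_left (Nat.le_sub_one_of_lt (ρ v).isLt))
    simp only [hv, ← hle, hσ, le_refl, and_self]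

/-- Block `i` is devoted to the cluster of `x i`, each member of which occurs at arbitrarily large
offsets. Hence members of the current cluster recur later in the block, and higher clusters are met
in later blocks. -/
theorem exists_coversFrame_of_total (G : KripkeFrame.{u}) [Finite G.World] [Nonempty G.World]
    (hr : ∀ s, G.Rel s s) (ht : ∀ s t r, G.Rel s t → G.Rel t r → G.Rel s r)
    (htot : ∀ s t, G.Rel s t ∨ G.Rel t s) :
    ∃ (T S : Type) (_ : AddMonoid T) (D : DynSystem T S) (g : S → G.World),
      LinearTime T ∧ D.CoversFrame G g := by
  classical
  let : Preorder G.World := { le := G.Rel, le_refl := hr, le_trans := ht }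
  have : Std.Total (α := G.World) (· ≤ ·) := ⟨htot⟩
  obtain ⟨x, hx, hx'⟩ := exists_monotone_enumeration G.World
  obtain ⟨f, hf⟩ := exists_surjective_nat G.World
  -- The first component of `Nat.unpair` takes each value infinitely often; worlds outside the
  -- block's cluster are replaced by `x a.blocks`.
  let g : OmegaSq → G.World := fun a =>
    if f a.offset.unpair.1 ≤ x a.blocks ∧ x a.blocks ≤ f a.offset.unpair.1
    then f a.offset.unpair.1 else x a.blocks
  have hg : ∀ a, g a ≤ x a.blocks ∧ x a.blocks ≤ g a := fun a => by
    simp only [g]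
    split_ifs with h
    · exact h
    · exact ⟨le_rfl, le_rfl⟩
  have hg' : ∀ i m v, v ≤ x i → x i ≤ v → ∃ k, m ≤ k ∧ g ⟨i, k⟩ = v := fun i m v h h' => by
    obtain ⟨j, rfl⟩ := hf v
    exact ⟨Nat.pair j m, Nat.right_le_pair j m, by simp [g, h, h']⟩
  let D : DynSystem OmegaSq OmegaSq := ⟨fun s t => s + t, add_zero, add_assoc⟩
  have hback : ∀ a v, g a ≤ v → ∃ b, MonoidLE OmegaSq a b ∧ g b = v := fun a v hav => by
    obtain ⟨i, hi, hi'⟩ := hx' v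
    -- If `i ≤ a.blocks`, then `v ≤ x i ≤ x a.blocks ≤ g a ≤ v`, so `v` lies in the current cluster
    -- and the block need not be left.
    rcases le_or_gt i a.blocks with h | h
    · obtain ⟨k, hk, hv⟩ := hg' a.blocks a.offset v (hi.trans (hx h)) ((hg a).2.trans hav)
      exact ⟨⟨a.blocks, k⟩, OmegaSq.monoidLE_iff.2 (Or.inr ⟨rfl, hk⟩), hv⟩
    · obtain ⟨k, -, hv⟩ := hg' i 0 v hi hi'
      exact ⟨_, OmegaSq.monoidLE_iff.2 (Or.inl h), hv⟩
  refine ⟨OmegaSq, OmegaSq, inferInstance, D, g, OmegaSq.linearTime, fun v => ?_,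
    fun a t => ?_, fun a v hav => ?_⟩
  · obtain ⟨i, hi, hi'⟩ := hx' v
    obtain ⟨k, -, hk⟩ := hg' i 0 v hi hi'
    exact ⟨_, hk⟩
  · exact (hg a).1.trans ((hx (Nat.le_add_right _ _)).trans (hg (a + t)).2)
  · obtain ⟨_, ⟨t, rfl⟩, hb⟩ := hback a v hav
    exact ⟨t, hb⟩

end LinearTime

/-! Completeness -/

section Completeness

variable {α : Type u}

theorem completeFor_logicS4 : CompleteFor (logicS4 α) orbitalFrames.{v, w} := by
  intro A hA
  by_contra hn
  obtain ⟨w₀, hw₀, s, hs⟩ := exists_filtrationModel_not_sat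
    Set.subset_union_left Set.subset_union_right hn
  obtain ⟨T, S, _, D, g, hg⟩ := exists_coversFrame_of_preorder _
    filtrationFrame_rel_refl (fun _ _ _ => filtrationFrame_rel_trans)
  exact hs (hg.sat_of_valid (hA _ ⟨_, _, _, D.isOrbitFrameOf_uliftSystem⟩) _ s)

theorem completeFor_logicS43 : CompleteFor (logicS43 α) linearTimeOrbitalFrames.{v, w} := by
  intro A hA
  by_contra hn
  have h4 : axioms4 α ⊆ axiomsT α ∪ axioms4 α ∪ axioms3 α := fun _ h => Or.inl (Or.inr h)
  obtain ⟨w₀, hw₀, s, hs⟩ := exists_filtrationModel_not_sat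
    (fun _ h => Or.inl (Or.inl h)) h4 hn
  have : Nonempty (filtrationFrame (axiomsT α ∪ axioms4 α ∪ axioms3 α) w₀ A).World := ⟨s⟩
  obtain ⟨T, S, _, D, g, hT, hg⟩ := exists_coversFrame_of_total (filtrationFrame _ w₀ A)
    filtrationFrame_rel_refl (fun _ _ _ => filtrationFrame_rel_trans)
    (filtrationFrame_rel_total h4 Set.subset_union_right hw₀)
  exact hs (hg.sat_of_valid (hA _ ⟨_, _, _, hT.ulift, D.isOrbitFrameOf_uliftSystem⟩) _ s)

theorem completeFor_logicS5 : CompleteFor (logicS5 α) invertibleOrbitalFrames.{v, w} := by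
  intro A hA
  by_contra hn
  have h4 : axioms4 α ⊆ axiomsT α ∪ axioms4 α ∪ axioms5 α := fun _ h => Or.inl (Or.inr h)
  obtain ⟨w₀, hw₀, s, hs⟩ := exists_filtrationModel_not_sat
    (fun _ h => Or.inl (Or.inl h)) h4 hn
  have : Nonempty (filtrationFrame (axiomsT α ∪ axioms4 α ∪ axioms5 α) w₀ A).World := ⟨s⟩
  obtain ⟨T, S, _, D, g, hT, hg⟩ := exists_coversFrame_of_univ (filtrationFrame _ w₀ A)
    (filtrationFrame_rel_univ h4 Set.subset_union_right hw₀)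
  exact hs (hg.sat_of_valid (hA _ ⟨_, _, _, hT.ulift, D.isOrbitFrameOf_uliftSystem⟩) _ s)

end Completeness

theorem mainTheorem1 (α : Type u) :
    (SoundFor (logicS4 α) orbitalFrames.{v, w} ∧
      CompleteFor (logicS4 α) orbitalFrames.{v, w}) ∧
    (SoundFor (logicS43 α) linearTimeOrbitalFrames.{v, w} ∧
      CompleteFor (logicS43 α) linearTimeOrbitalFrames.{v, w}) ∧
    (SoundFor (logicS5 α) invertibleOrbitalFrames.{v, w} ∧
      CompleteFor (logicS5 α) invertibleOrbitalFrames.{v, w}) :=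
  ⟨⟨soundFor_logicS4, completeFor_logicS4⟩, ⟨soundFor_logicS43, completeFor_logicS43⟩,
    ⟨soundFor_logicS5, completeFor_logicS5⟩⟩
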